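/- Let $n\ge 1$ and let $\mathcal G$ be an undirected connected graph (without loops) on the agents $\{1,\dots,n\}$; write $\mathcal N_i$ for the set of neighbors of $i$. Let $\varphi_i:\mathbb R^{p_i}\to\mathbb R$ and $h_i:\mathbb R^d\to\mathbb R$ be convex, let $\mathcal Y\subset\mathbb R^d$ and $\mathcal Z_i\subset\mathbb R^{p_i}$ be convex and compact, let $\Xi\subset\mathbb R^m$ be compact, and let $g_i:\mathbb R^d\times\mathbb R^{p_i}\times\mathbb R^m\to\mathbb R$ be locally Lipschitz, with $(y,z_i)\mapsto g_i(y,z_i,\xi)$ convex for every $\xi\in\Xi$ $(1\le i\le n)$. Assume that the semi-infinite program $$\min_{y,\,z_1,\dots,z_n}\ \sum_{i=1}^n\bigl(\varphi_i(z_i)+h_i(y)\bigr)\quad\text{s.t. } y\in\mathcal Y,\ z_i\in\mathcal Z_i,\ g_i(y,z_i,\xi)\le 0\ \ \forall \xi\in\Xi,\ \forall i\in\{1,\dots,n\}$$ is feasible, and let $J^\star$ be its optimal value. Let $\rho>0$ and $\epsilon>0$. Consider the distributed cutting-surface ADMM: initialize $y_i^0\in\mathcal Y$, $z_i^0\in\mathcal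 Z_i$ arbitrarily, $p_i^0=0$ and $\Xi_i^0=\emptyset$, and for $k=0,1,2,\dots$ let every agent $i$ perform the following steps. 1. Set $p_i^{k+1}=p_i^k+\rho\sum_{j\in\mathcal N_i}(y_i^k-y_j^k)$. 2. Let $(y_i^{k+1},z_i^{k+1})$ be any minimizer of $$\varphi_i(z_i)+h_i(y_i)+y_i^\top p_i^{k+1}+\rho\sum_{j\in\mathcal N_i}\Bigl\|y_i-\tfrac{y_i^k+y_j^k}{2}\Bigr\|^2$$ over $\mathcal F_i^k=\{(y_i,z_i): y_i\in\mathcal Y,\ z_i\in\mathcal Z_i,\ g_i(y_i,z_i,\xi)\le 0\ \forall \xi\in\Xi_i^k\}$. 3. Choose any $\xi_i^{k+1}\in\Xi$ with $g_i(y_i^{k+1},z_i^{k+1},\xi_i^{k+1})\ge\max_{\xi\in\Xi}g_i(y_i^{k+1},z_i^{k+1},\xi)-\frac{\epsilon}{2}$. 4. Set $\Xi_i^{k+1}=\Xi_i^k\cup\{\xi_i^{k+1}\}$ if $g_i(y_i^{k+1},z_i^{k+1},\xi_i^{k+1})>\frac{\epsilon}{2}$, and $\Xi_i^{k+1}=\Xi_i^k$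 otherwise. Then, for every infinite sequence of iterates generated in this way, there is a finite $K\ge 1$ such that $\Xi_i^{k_1}=\Xi_i^{k_2}$ for all $i$ and all $k_1,k_2\ge K$. Moreover, every limit point $(\bar y_i,\bar z_i)_{i=1}^n$ of the sequence $\bigl((y_i^k,z_i^k)_{i=1}^n\bigr)_{k\ge 0}$ satisfies $\bar y_i=\bar y_j$ for all $i,j$, $$\max_{1\le i\le n}\ \max_{\xi\in\Xi}\ g_i(\bar y_i,\bar z_i,\xi)\le\epsilon\qquad\text{and}\qquad\sum_{i=1}^n\bigl(\varphi_i(\bar z_i)+h_i(\bar y_i)\bigr)\le J^\star .$$ -/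

import Mathlib

/-- The Euclidean space `ℝ^k` with its 2-norm. -/
abbrev Vec (k : ℕ) : Type := EuclideanSpace ℝ (Fin k)

/-- The data of the convex semi-infinite program
`min ∑ i, (φ i (z i) + h i y)` over `y ∈ Y`, `z i ∈ Z i`, subject to
`g i (y, z i, ξ) ≤ 0` for all `ξ ∈ Ξ` and all `i`, together with the standing assumptions
on it. -/
structure ConvexSIP (n d m : ℕ) (p : Fin n → ℕ) where
  /-- local objectives -/
  φ : (i : Fin n) → Vec (p i) → ℝ
  /-- objectives of the global variable -/
  h : Fin n → Vec d → ℝ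
  /-- constraint functions, of the argument `(y, z i, ξ)` -/
  g : (i : Fin n) → Vec d × Vec (p i) × Vec m → ℝ
  /-- domain of the global variable -/
  Y : Set (Vec d)
  /-- domains of the local variables -/
  Z : (i : Fin n) → Set (Vec (p i))
  /-- uncertainty set -/
  Ξ : Set (Vec m)
  convex_φ : ∀ i, ConvexOn ℝ Set.univ (φ i)
  convex_h : ∀ i, ConvexOn ℝ Set.univ (h i)
  lipschitz_g : ∀ i, LocallyLipschitz (g i)
  convex_g : ∀ i, ∀ ξ ∈ Ξ,
    ConvexOn ℝ Set.univ (fun w : Vec d × Vec (p i) => g i (w.1, w.2, ξ))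
  convex_Y : Convex ℝ Y
  compact_Y : IsCompact Y
  convex_Z : ∀ i, Convex ℝ (Z i)
  compact_Z : ∀ i, IsCompact (Z i)
  compact_Ξ : IsCompact Ξ

namespace ConvexSIP

variable {n d m : ℕ} {p : Fin n → ℕ} (P : ConvexSIP n d m p)

/-- The feasible set of the semi-infinite program, in the variables `(y, (z i)_i)`. -/
def feasibleSet : Set (Vec d × ((i : Fin n) → Vec (p i))) :=
  {w | w.1 ∈ P.Y ∧ (∀ i, w.2 i ∈ P.Z i) ∧ ∀ i, ∀ ξ ∈ P.Ξ, P.g i (w.1, w.2 i, ξ) ≤ 0}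

/-- The objective of the semi-infinite program. -/
def objective (w : Vec d × ((i : Fin n) → Vec (p i))) : ℝ :=
  ∑ i, (P.φ i (w.2 i) + P.h i w.1)

/-- The optimal value `J*` of the semi-infinite program (meaningful when it is feasible). -/
noncomputable def optimalValue : ℝ :=
  sInf (P.objective '' P.feasibleSet)

/-- The feasibility set of agent `i` when the constraint is imposed for the cuts in `C` only. -/
def cutFeasibleSet (i : Fin n) (C : Set (Vec m)) : Set (Vec d × Vec (p i)) :=
  {w | w.1 ∈ P.Y ∧ w.2 ∈ P.Z i ∧ ∀ ξ ∈ C, P.g i (w.1, w.2, ξ) ≤ 0}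

/-- The function of `w = (y_i, z_i)` that agent `i` minimizes in one ADMM step, where `q` is the
agent's updated dual variable and `yk j` is the current estimate of agent `j`:
`φ i (z_i) + h i (y_i) + y_iᵀ q + ρ ∑_{j ∈ N_i} ‖y_i - (yk i + yk j) / 2‖²`. -/
noncomputable def admmObjective (G : SimpleGraph (Fin n)) [DecidableRel G.Adj] (ρ : ℝ)
    (i : Fin n) (q : Vec d) (yk : Fin n → Vec d) (w : Vec d × Vec (p i)) : ℝ :=
  P.φ i w.2 + P.h i w.1 + inner ℝ w.1 q
    + ρ * ∑ j ∈ G.neighborFinset i, ‖w.1 - (1 / 2 : ℝ) • (yk i + yk j)‖ ^ 2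

/-- The sequences `y`, `z` (primal), `q` (dual), `ξ` (approximate maximizers) and `C` (cut sets),
indexed by the iteration and then by the agent, are generated by the distributed cutting-surface
ADMM over the communication graph `G` with regularization `ρ` and tolerance `ε`. The entry `ξ 0` is
not used. Minimizers and approximate maximizers are arbitrary. -/
structure IsCuttingSurfaceADMM (G : SimpleGraph (Fin n)) [DecidableRel G.Adj] (ρ ε : ℝ)
    (y : ℕ → Fin n → Vec d) (z : ℕ → (i : Fin n) → Vec (p i)) (q : ℕ → Fin n → Vec d)
    (ξ : ℕ → Fin n → Vec m) (C : ℕ → Fin n → Set (Vec m)) : Prop where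
  y_init : ∀ i, y 0 i ∈ P.Y
  z_init : ∀ i, z 0 i ∈ P.Z i
  q_init : ∀ i, q 0 i = 0
  C_init : ∀ i, C 0 i = ∅
  q_step : ∀ k i, q (k + 1) i = q k i + ρ • ∑ j ∈ G.neighborFinset i, (y k i - y k j)
  primal_mem : ∀ k i, (y (k + 1) i, z (k + 1) i) ∈ P.cutFeasibleSet i (C k i)
  primal_min : ∀ k i, IsMinOn (P.admmObjective G ρ i (q (k + 1) i) (y k))
    (P.cutFeasibleSet i (C k i)) (y (k + 1) i, z (k + 1) i)
  ξ_mem : ∀ k i, ξ (k + 1) i ∈ P.Ξ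
  ξ_approx : ∀ k i, ∀ ζ ∈ P.Ξ,
    P.g i (y (k + 1) i, z (k + 1) i, ζ) - ε / 2
      ≤ P.g i (y (k + 1) i, z (k + 1) i, ξ (k + 1) i)
  C_step : ∀ k i, C (k + 1) i =
    if ε / 2 < P.g i (y (k + 1) i, z (k + 1) i, ξ (k + 1) i)
    then C k i ∪ {ξ (k + 1) i} else C k i

end ConvexSIP

/-!
Finite termination of the cuts is a compactness argument: a limit of infinitely many violated
triples `(y, z, ξ)` of an agent would have constraint value at least `ε / 2`, while later iterates
satisfy all earlier cuts, so that the value is also at most `0`.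

Once the cuts are fixed, the iteration is an ADMM for a convex consensus problem on a compact set
which relaxes the semi-infinite program. No constraint qualification is assumed, so the dual
problem need not have a solution, the dual variables may be unbounded, and the usual Lyapunov
function is not available. With `B y = (y i - y j)` and `S y = (y i + y j)` over the adjacent
ordered pairs, put `a k = B (∑ l ≤ k, y l)` and `b k = S (y k)`. The optimality conditions of the
local problems become one variational inequality (`sum_variational_inequality`), which makes
`x = (a, b)` a proximal point sequence of a monotone operator. The argument then runs as follows.

* By monotonicity the chords `‖x (k + j) - x k‖` decrease in `k`, and their decrease controls the
  variation of the displacements `x (k + 1) - x k` (`chord_sq_add_le`).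
* The Lagrangian values along the iterates are bounded above, and below on average. Summing the
  ascent inequality over all windows of length `j` that start before `N` telescopes to
  `∑ k < N, ‖a (k + j) - a k‖² ≤ C (j² + j ∑ k < N, ‖b (k + 1) - b k‖)`
  (`sum_chord_sq_le_of_variational_inequality`).
* A displacement is a mean of its differences from later ones plus a chord slope. With windows of
  length `√N` these two facts give `‖x (k + 1) - x k‖ = O(k^(-1/2))` (`displacement_le_div_sqrt`),
  hence consensus in the limit.
* Consensus implies that the values are asymptotically at least the optimal one, whence
  `‖a k‖² = o(k)`. So `⟪a (k + 1), a (k + 1) - a k⟫`, which bounds the excess of the value, tends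
  to `0` (`primalDual_eventually_le`).
-/

/-! ### Monotone displacement sequences -/

theorem norm_sq_add_norm_sub_sq_le_of_inner_nonpos {H : Type*} [NormedAddCommGroup H]
    [InnerProductSpace ℝ H] {u v : H} (h : inner ℝ v (v - u) ≤ 0) :
    ‖v‖ ^ 2 + ‖v - u‖ ^ 2 ≤ ‖u‖ ^ 2 := by
  have e := norm_sub_sq_real v (v - u)
  rw [sub_sub_cancel] at e
  linarith

theorem sum_range_one_div_sqrt_succ_le (N : ℕ) :
    ∑ k ∈ Finset.range N, 1 / √((k : ℝ) + 1) ≤ 2 * √(N : ℝ) := by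
  induction N with
  | zero => simp
  | succ N ih =>
    rw [Finset.sum_range_succ]
    push_cast
    have hp : 0 < √((N : ℝ) + 1) := Real.sqrt_pos.2 (by positivity)
    have h1 : √((N : ℝ) + 1) ^ 2 = N + 1 := Real.sq_sqrt (by positivity)
    have h0 : √(N : ℝ) ^ 2 = N := Real.sq_sqrt (by positivity)
    have : 1 / √((N : ℝ) + 1) ≤ 2 * √((N : ℝ) + 1) - 2 * √(N : ℝ) := by
      rw [div_le_iff₀ hp]
      nlinarith [sq_nonneg (√((N : ℝ) + 1) - √(N : ℝ))]
    linarith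

section Displacement

variable {H : Type*} [NormedAddCommGroup H] [InnerProductSpace ℝ H] {x : ℕ → H}

/-- Shifting both ends of a chord of the trajectory shortens it, and the loss controls the
variation of the displacement. -/
theorem chord_sq_add_le
    (hmono : ∀ k l, inner ℝ (x (k + 1) - x (l + 1)) ((x (k + 1) - x k) - (x (l + 1) - x l)) ≤ 0)
    (j k : ℕ) :
    ‖x (k + 1 + j) - x (k + 1)‖ ^ 2
      + ‖(x (k + j + 1) - x (k + j)) - (x (k + 1) - x k)‖ ^ 2 ≤ ‖x (k + j) - x k‖ ^ 2 := by
  have h := hmono (k + j) k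
  have e : (x (k + j + 1) - x (k + j)) - (x (k + 1) - x k)
      = (x (k + j + 1) - x (k + 1)) - (x (k + j) - x k) := by abel
  rw [e] at h ⊢
  rw [show k + 1 + j = k + j + 1 by omega]
  exact norm_sq_add_norm_sub_sq_le_of_inner_nonpos h

theorem antitone_chord
    (hmono : ∀ k l, inner ℝ (x (k + 1) - x (l + 1)) ((x (k + 1) - x k) - (x (l + 1) - x l)) ≤ 0)
    (j : ℕ) : Antitone fun k => ‖x (k + j) - x k‖ := by
  refine antitone_nat_of_succ_le fun k => ?_
  have h := chord_sq_add_le hmono j k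
  exact le_of_sq_le_sq (by nlinarith [sq_nonneg ‖(x (k + j + 1) - x (k + j)) - (x (k + 1) - x k)‖])
    (norm_nonneg _)

/-- Along the trajectory, displacements `j` steps apart differ by a square-summable amount, the sum
being at most the first chord squared. -/
theorem sum_displacement_variation_le
    (hmono : ∀ k l, inner ℝ (x (k + 1) - x (l + 1)) ((x (k + 1) - x k) - (x (l + 1) - x l)) ≤ 0)
    (j N M : ℕ) :
    ∑ i ∈ Finset.range M,
        ‖(x (N + i + j + 1) - x (N + i + j)) - (x (N + i + 1) - x (N + i))‖ ^ 2
      ≤ ‖x (N + j) - x N‖ ^ 2 := by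
  have key : ∀ M : ℕ, ∑ i ∈ Finset.range M,
        ‖(x (N + i + j + 1) - x (N + i + j)) - (x (N + i + 1) - x (N + i))‖ ^ 2
      + ‖x (N + M + j) - x (N + M)‖ ^ 2 ≤ ‖x (N + j) - x N‖ ^ 2 := by
    intro M
    induction M with
    | zero => simp
    | succ M ih =>
      rw [Finset.sum_range_succ]
      have h := chord_sq_add_le hmono j (N + M)
      rw [show N + (M + 1) = N + M + 1 by omega]
      linarith
  have := key M
  nlinarith [sq_nonneg ‖x (N + M + j) - x (N + M)‖]

/-- A displacement is the mean of its differences from the next `τ` ones, plus the slope of the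
chord over these `τ` steps. -/
theorem sq_mul_norm_displacement_sq_le (x : ℕ → H) (k τ : ℕ) :
    (τ : ℝ) ^ 2 * ‖x (k + 1) - x k‖ ^ 2
      ≤ 2 * τ * ∑ j ∈ Finset.range τ, ‖(x (k + j + 1) - x (k + j)) - (x (k + 1) - x k)‖ ^ 2
        + 2 * ‖x (k + τ) - x k‖ ^ 2 := by
  set D : ℕ → H := fun j => (x (k + j + 1) - x (k + j)) - (x (k + 1) - x k) with hD
  have hsum : ∑ j ∈ Finset.range τ, D j = (x (k + τ) - x k) - (τ : ℝ) • (x (k + 1) - x k) := by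
    rw [hD, Finset.sum_sub_distrib, Finset.sum_const, Finset.card_range, Nat.cast_smul_eq_nsmul]
    congr 1
    exact Finset.sum_range_sub (fun j => x (k + j)) τ
  have h1 : ‖(τ : ℝ) • (x (k + 1) - x k)‖ ≤ ‖x (k + τ) - x k‖ + ∑ j ∈ Finset.range τ, ‖D j‖ := by
    have : (τ : ℝ) • (x (k + 1) - x k) = (x (k + τ) - x k) - ∑ j ∈ Finset.range τ, D j := by
      rw [hsum]; abel
    rw [this]
    exact (norm_sub_le _ _).trans (by gcongr; exact norm_sum_le _ _)
  have h2 : (∑ j ∈ Finset.range τ, ‖D j‖) ^ 2 ≤ τ * ∑ j ∈ Finset.range τ, ‖D j‖ ^ 2 := by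
    simpa using sq_sum_le_card_mul_sum_sq (s := Finset.range τ) (f := fun j => ‖D j‖)
  have h3 : ‖(τ : ℝ) • (x (k + 1) - x k)‖ ^ 2 = (τ : ℝ) ^ 2 * ‖x (k + 1) - x k‖ ^ 2 := by
    rw [norm_smul, mul_pow, Real.norm_natCast]
  rw [← h3]
  have h4 := pow_le_pow_left₀ (norm_nonneg _) h1 2
  nlinarith [sq_nonneg (‖x (k + τ) - x k‖ - ∑ j ∈ Finset.range τ, ‖D j‖)]

/-- If the chords are quadratically bounded on average, up to the path length, then the
displacement at time `2 τ²` is controlled by the path length of the first `τ²` steps. -/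
theorem sq_mul_displacement_sq_le_of_chord_bound
    (hmono : ∀ k l, inner ℝ (x (k + 1) - x (l + 1)) ((x (k + 1) - x k) - (x (l + 1) - x l)) ≤ 0)
    {C : ℝ} (hC : 0 ≤ C)
    (hchord : ∀ N j : ℕ, ∑ k ∈ Finset.range N, ‖x (k + 1 + j) - x (k + 1)‖ ^ 2
      ≤ C * ((j : ℝ) ^ 2 + j * ∑ k ∈ Finset.range N, ‖x (k + 1) - x k‖ + N))
    {τ : ℕ} (hτ : 0 < τ) :
    (τ : ℝ) ^ 2 * ‖x (2 * τ ^ 2 + 1) - x (2 * τ ^ 2)‖ ^ 2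
      ≤ 4 * C * (2 + (∑ k ∈ Finset.range (τ ^ 2), ‖x (k + 1) - x k‖) / τ) := by
  set S := ∑ k ∈ Finset.range (τ ^ 2), ‖x (k + 1) - x k‖ with hS
  have hS0 : 0 ≤ S := Finset.sum_nonneg fun _ _ => norm_nonneg _
  have hτ' : (0 : ℝ) < τ := by exact_mod_cast hτ
  have hN : (0 : ℝ) < (τ : ℝ) ^ 2 := by positivity
  set W := C * (2 + S / τ) with hW
  have hWe : (τ : ℝ) ^ 2 * W = C * ((τ : ℝ) ^ 2 + τ * S + (τ : ℝ) ^ 2) := by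
    rw [hW]; field_simp; ring
  -- chords of length `j ≤ τ` that start at time `τ²`
  have hc : ∀ j ≤ τ, ‖x (τ ^ 2 + j) - x (τ ^ 2)‖ ^ 2 ≤ W := by
    intro j hj
    have h1 := hchord (τ ^ 2) j
    have h2 : (τ : ℝ) ^ 2 * ‖x (τ ^ 2 + j) - x (τ ^ 2)‖ ^ 2
        ≤ ∑ k ∈ Finset.range (τ ^ 2), ‖x (k + 1 + j) - x (k + 1)‖ ^ 2 := by
      have := Finset.card_nsmul_le_sum (Finset.range (τ ^ 2))
        (fun k => ‖x (k + 1 + j) - x (k + 1)‖ ^ 2) (‖x (τ ^ 2 + j) - x (τ ^ 2)‖ ^ 2)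
        (fun k hk => by
          have hk' : k + 1 ≤ τ ^ 2 := Finset.mem_range.1 hk
          exact pow_le_pow_left₀ (norm_nonneg _) (antitone_chord hmono j hk') 2)
      simpa using this
    have hj' : (j : ℝ) ≤ τ := by exact_mod_cast hj
    have h3 : C * ((j : ℝ) ^ 2 + j * S + ((τ ^ 2 : ℕ) : ℝ)) ≤ (τ : ℝ) ^ 2 * W := by
      rw [hWe]; push_cast; gcongr
    exact le_of_mul_le_mul_left (h2.trans (h1.trans h3)) hN
  have hanti : Antitone fun k => ‖x (k + 1) - x k‖ := antitone_chord hmono 1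
  have hstep : ∀ i ∈ Finset.range (τ ^ 2),
      (τ : ℝ) ^ 2 * ‖x (2 * τ ^ 2 + 1) - x (2 * τ ^ 2)‖ ^ 2 ≤
      2 * τ * ∑ j ∈ Finset.range τ,
        ‖(x (τ ^ 2 + i + j + 1) - x (τ ^ 2 + i + j)) - (x (τ ^ 2 + i + 1) - x (τ ^ 2 + i))‖ ^ 2
        + 2 * W := by
    intro i hi
    have hi' := Finset.mem_range.1 hi
    have h1 : ‖x (2 * τ ^ 2 + 1) - x (2 * τ ^ 2)‖ ≤ ‖x (τ ^ 2 + i + 1) - x (τ ^ 2 + i)‖ :=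
      hanti (by omega)
    have h2 := sq_mul_norm_displacement_sq_le x (τ ^ 2 + i) τ
    have h3 : ‖x (τ ^ 2 + i + τ) - x (τ ^ 2 + i)‖ ^ 2 ≤ W :=
      (pow_le_pow_left₀ (norm_nonneg _) (antitone_chord hmono τ (Nat.le_add_right _ i)) 2).trans
        (hc τ le_rfl)
    have h4 : (τ : ℝ) ^ 2 * ‖x (2 * τ ^ 2 + 1) - x (2 * τ ^ 2)‖ ^ 2
        ≤ (τ : ℝ) ^ 2 * ‖x (τ ^ 2 + i + 1) - x (τ ^ 2 + i)‖ ^ 2 := by gcongr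
    linarith
  have hsum := Finset.sum_le_sum hstep
  rw [Finset.sum_add_distrib, Finset.sum_const, Finset.sum_const, ← Finset.mul_sum,
    Finset.sum_comm] at hsum
  simp only [Finset.card_range, nsmul_eq_mul] at hsum
  have hvar : ∑ j ∈ Finset.range τ, ∑ i ∈ Finset.range (τ ^ 2),
        ‖(x (τ ^ 2 + i + j + 1) - x (τ ^ 2 + i + j)) - (x (τ ^ 2 + i + 1) - x (τ ^ 2 + i))‖ ^ 2
      ≤ τ * W := by
    refine (Finset.sum_le_card_nsmul _ _ W fun j hj => ?_).trans (by simp)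
    exact (sum_displacement_variation_le hmono j (τ ^ 2) (τ ^ 2)).trans
      (hc j (Finset.mem_range.1 hj).le)
  push_cast at hsum
  have h5 : (τ : ℝ) ^ 2 * ((τ : ℝ) ^ 2 * ‖x (2 * τ ^ 2 + 1) - x (2 * τ ^ 2)‖ ^ 2)
      ≤ (τ : ℝ) ^ 2 * (4 * W) := by
    have : 2 * (τ : ℝ) * ∑ j ∈ Finset.range τ, ∑ i ∈ Finset.range (τ ^ 2),
        ‖(x (τ ^ 2 + i + j + 1) - x (τ ^ 2 + i + j)) - (x (τ ^ 2 + i + 1) - x (τ ^ 2 + i))‖ ^ 2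
        ≤ 2 * τ * (τ * W) := by gcongr
    nlinarith
  have := le_of_mul_le_mul_left h5 hN
  rw [hW] at this
  linarith

/-- The displacements decay like `k^(-1/2)`. -/
theorem displacement_le_div_sqrt
    (hmono : ∀ k l, inner ℝ (x (k + 1) - x (l + 1)) ((x (k + 1) - x k) - (x (l + 1) - x l)) ≤ 0)
    {C : ℝ} (hC : 0 ≤ C)
    (hchord : ∀ N j : ℕ, ∑ k ∈ Finset.range N, ‖x (k + 1 + j) - x (k + 1)‖ ^ 2
      ≤ C * ((j : ℝ) ^ 2 + j * ∑ k ∈ Finset.range N, ‖x (k + 1) - x k‖ + N)) :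
    ∃ A : ℝ, 0 ≤ A ∧ ∀ k : ℕ, ‖x (k + 1) - x k‖ ≤ A / √((k : ℝ) + 1) := by
  have hanti : Antitone fun k => ‖x (k + 1) - x k‖ := antitone_chord hmono 1
  have hd0 := norm_nonneg (x (0 + 1) - x 0)
  -- chosen so that `64 C + 64 C A ≤ A²`, which closes the induction
  refine ⟨64 * C + 1 + 2 * ‖x (0 + 1) - x 0‖, by positivity, fun k => ?_⟩
  set A := 64 * C + 1 + 2 * ‖x (0 + 1) - x 0‖ with hA
  induction k using Nat.strong_induction_on with
  | _ k ih =>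
    have hsq : 0 < √((k : ℝ) + 1) := Real.sqrt_pos.2 (by positivity)
    rw [le_div_iff₀ hsq]
    by_cases hk : k < 2
    · have h1 : √((k : ℝ) + 1) ≤ 2 := by
        rw [Real.sqrt_le_left (by norm_num)]
        have : (k : ℝ) < 2 := by exact_mod_cast hk
        linarith
      have h2 : ‖x (k + 1) - x k‖ ≤ ‖x (0 + 1) - x 0‖ := hanti (Nat.zero_le k)
      calc ‖x (k + 1) - x k‖ * √((k : ℝ) + 1) ≤ ‖x (0 + 1) - x 0‖ * 2 := by gcongr
        _ ≤ A := by linarith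
    · set τ := Nat.sqrt (k / 2) with hτ
      have hτ0 : 0 < τ := Nat.sqrt_pos.2 (by omega)
      have hlow : τ ^ 2 ≤ k / 2 := Nat.sqrt_le' _
      have hup : k / 2 < (τ + 1) ^ 2 := Nat.lt_succ_sqrt' _
      have hk8 : k + 1 ≤ 8 * τ ^ 2 := by
        have : (τ + 1) ^ 2 ≤ 4 * τ ^ 2 := by nlinarith
        omega
      have hτ' : (0 : ℝ) < τ := by exact_mod_cast hτ0
      have hmain := sq_mul_displacement_sq_le_of_chord_bound hmono hC hchord hτ0
      have hS : (∑ i ∈ Finset.range (τ ^ 2), ‖x (i + 1) - x i‖) / τ ≤ 2 * A := by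
        rw [div_le_iff₀ hτ']
        calc ∑ i ∈ Finset.range (τ ^ 2), ‖x (i + 1) - x i‖
            ≤ ∑ i ∈ Finset.range (τ ^ 2), A * (1 / √((i : ℝ) + 1)) := by
              refine Finset.sum_le_sum fun i hi => ?_
              have := ih i (by have := Finset.mem_range.1 hi; omega)
              rwa [mul_one_div]
          _ ≤ A * (2 * √((τ ^ 2 : ℕ) : ℝ)) := by
              rw [← Finset.mul_sum]
              gcongr
              exact sum_range_one_div_sqrt_succ_le _
          _ = 2 * A * τ := by
              push_cast
              rw [Real.sqrt_sq hτ'.le]; ring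
      have hle : ‖x (k + 1) - x k‖ ≤ ‖x (2 * τ ^ 2 + 1) - x (2 * τ ^ 2)‖ := hanti (by omega)
      have hk8' : (k : ℝ) + 1 ≤ 8 * (τ : ℝ) ^ 2 := by exact_mod_cast hk8
      refine le_of_sq_le_sq ?_ (by positivity)
      rw [mul_pow, Real.sq_sqrt (by positivity)]
      calc ‖x (k + 1) - x k‖ ^ 2 * ((k : ℝ) + 1)
          ≤ ‖x (2 * τ ^ 2 + 1) - x (2 * τ ^ 2)‖ ^ 2 * (8 * (τ : ℝ) ^ 2) := by gcongr
        _ = 8 * ((τ : ℝ) ^ 2 * ‖x (2 * τ ^ 2 + 1) - x (2 * τ ^ 2)‖ ^ 2) := by ring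
        _ ≤ 8 * (4 * C * (2 + 2 * A)) := by
            refine mul_le_mul_of_nonneg_left (hmain.trans ?_) (by norm_num)
            gcongr
        _ ≤ A ^ 2 := by nlinarith [mul_nonneg hC hd0]

end Displacement

/-! ### Primal-dual sequences without a dual solution -/

section PrimalDual

variable {H₁ H₂ : Type*} [NormedAddCommGroup H₁] [InnerProductSpace ℝ H₁]
  [NormedAddCommGroup H₂] [InnerProductSpace ℝ H₂]

theorem half_norm_sq_sub_le_inner {H : Type*} [NormedAddCommGroup H] [InnerProductSpace ℝ H]
    (u v : H) : (‖v‖ ^ 2 - ‖u‖ ^ 2) / 2 ≤ inner ℝ v (v - u) := by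
  have e := norm_sub_sq_real v (v - u)
  rw [sub_sub_cancel] at e
  nlinarith [sq_nonneg ‖v - u‖]

theorem inner_sub_le_two_mul_norm {H : Type*} [NormedAddCommGroup H] [InnerProductSpace ℝ H]
    {β : ℝ} (w : H) {u v : H} (hu : ‖u‖ ≤ β) (hv : ‖v‖ ≤ β) :
    -inner ℝ w (u - v) ≤ 2 * β * ‖w‖ := by
  have h1 := neg_le_of_abs_le (abs_real_inner_le_norm w (u - v))
  have h2 : ‖u - v‖ ≤ 2 * β := (norm_sub_le _ _).trans (by linarith)
  nlinarith [norm_nonneg w]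

variable {a : ℕ → H₁} {b : ℕ → H₂} {g : ℕ → ℝ} {bstar : H₂} {f₀ m β : ℝ}

/-- The chord bound for `(a, b)`. The Lagrangian values `g k + ⟪a (k+1), a (k+1) - a k⟫` play the
role of the dual function along `a`: they are bounded above, and below on average, so that the sum
of their increments over a window is at most linear in the length of the increments. -/
theorem sum_chord_sq_le_of_variational_inequality
    (hvar : ∀ k l, g k + inner ℝ (a (k + 1)) ((a (k + 1) - a k) - (a (l + 1) - a l))
      + inner ℝ (b (k + 1) - b k) (b (k + 1) - b (l + 1)) ≤ g l)
    (hstar : ∀ k, g k + inner ℝ (a (k + 1)) (a (k + 1) - a k)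
      + inner ℝ (b (k + 1) - b k) (b (k + 1) - bstar) ≤ f₀)
    (hb : ∀ k, ‖b k‖ ≤ β) (hbstar : ‖bstar‖ ≤ β) (hm : ∀ k, m ≤ g k) :
    ∃ C : ℝ, 0 ≤ C ∧ ∀ N j : ℕ,
      ∑ k ∈ Finset.range N, ‖a (k + 1 + j) - a (k + 1)‖ ^ 2
        ≤ C * ((j : ℝ) ^ 2 + j * ∑ k ∈ Finset.range N, ‖b (k + 1) - b k‖) := by
  have hβ : 0 ≤ β := (norm_nonneg _).trans hbstar
  set L : ℕ → ℝ := fun k => g k + inner ℝ (a (k + 1)) (a (k + 1) - a k) with hL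
  have hup : ∀ k, L k ≤ f₀ + 4 * β ^ 2 := by
    intro k
    have h1 := hstar k
    have h2 := inner_sub_le_two_mul_norm (b (k + 1) - b k) (hb (k + 1)) hbstar
    have h3 : ‖b (k + 1) - b k‖ ≤ 2 * β := (norm_sub_le _ _).trans (by linarith [hb k, hb (k + 1)])
    simp only [hL]
    nlinarith
  have hlow : ∀ n : ℕ, n * m - ‖a 0‖ ^ 2 / 2 ≤ ∑ k ∈ Finset.range n, L k := by
    intro n
    have h : n * m + (‖a n‖ ^ 2 - ‖a 0‖ ^ 2) / 2 ≤ ∑ k ∈ Finset.range n, L k := by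
      induction n with
      | zero => simp
      | succ n ih =>
        rw [Finset.sum_range_succ]
        have h1 := half_norm_sq_sub_le_inner (a n) (a (n + 1))
        have h2 := hm n
        simp only [hL] at ih ⊢
        push_cast
        linarith
    nlinarith [sq_nonneg ‖a n‖]
  -- ascent inequality along the window starting at `k + 1`
  have hasc : ∀ k j : ℕ, ‖a (k + 1 + j) - a (k + 1)‖ ^ 2 / 2
      ≤ ∑ i ∈ Finset.range j, (L (k + 1 + i) - L k) + j * (2 * β * ‖b (k + 1) - b k‖) := by
    intro k j
    induction j with
    | zero => simp
    | succ j ih =>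
      rw [Finset.sum_range_succ]
      have h1 := half_norm_sq_sub_le_inner (a (k + 1 + j) - a (k + 1))
        (a (k + 1 + j + 1) - a (k + 1))
      rw [sub_sub_sub_cancel_right] at h1
      have h2 := hvar k (k + 1 + j)
      have h3 := inner_sub_le_two_mul_norm (b (k + 1) - b k) (hb (k + 1)) (hb (k + 1 + j + 1))
      rw [inner_sub_left] at h1
      rw [inner_sub_right (a (k + 1))] at h2
      simp only [hL] at ih ⊢
      rw [← add_assoc (k + 1) j 1]
      push_cast
      linarith
  have hwin : ∀ N l : ℕ, ∑ k ∈ Finset.range N, (L (k + 1 + l) - L k)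
      ≤ (l + 1) * (f₀ + 4 * β ^ 2 - m) + ‖a 0‖ ^ 2 / 2 := by
    intro N l
    have e1 := Finset.sum_range_add L N (1 + l)
    have e2 := Finset.sum_range_add L (1 + l) N
    rw [Finset.sum_sub_distrib]
    have e3 : ∑ k ∈ Finset.range N, L (k + 1 + l) = ∑ k ∈ Finset.range N, L (1 + l + k) :=
      Finset.sum_congr rfl fun k _ => by rw [show k + 1 + l = 1 + l + k by omega]
    have h1 : ∑ k ∈ Finset.range (1 + l), L (N + k) ≤ (1 + l : ℕ) * (f₀ + 4 * β ^ 2) := by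
      refine (Finset.sum_le_card_nsmul (Finset.range (1 + l)) (fun k => L (N + k)) _
        fun k _ => hup (N + k)).trans_eq ?_
      rw [Finset.card_range, nsmul_eq_mul]
    have h2 := hlow (1 + l)
    rw [add_comm N (1 + l)] at e1
    rw [e3]
    push_cast at h1 h2
    linarith
  set U := |f₀ + 4 * β ^ 2 - m| + ‖a 0‖ ^ 2 / 2 with hU
  have hU0 : 0 ≤ U := by positivity
  refine ⟨2 * U + 4 * β, by positivity, fun N j => ?_⟩
  set S := ∑ k ∈ Finset.range N, ‖b (k + 1) - b k‖ with hS
  have hS0 : 0 ≤ S := Finset.sum_nonneg fun _ _ => norm_nonneg _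
  have h1 : ∑ k ∈ Finset.range N, ‖a (k + 1 + j) - a (k + 1)‖ ^ 2 / 2
      ≤ ∑ i ∈ Finset.range j, ∑ k ∈ Finset.range N, (L (k + 1 + i) - L k) + j * (2 * β * S) := by
    rw [Finset.sum_comm, hS, Finset.mul_sum, Finset.mul_sum, ← Finset.sum_add_distrib]
    exact Finset.sum_le_sum fun k _ => hasc k j
  have h2 : ∑ i ∈ Finset.range j, ∑ k ∈ Finset.range N, (L (k + 1 + i) - L k) ≤ j * (j * U) := by
    refine (Finset.sum_le_card_nsmul _ _ (j * U) fun i hi => ?_).trans (by simp)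
    have hij : (i : ℝ) + 1 ≤ j := by exact_mod_cast Finset.mem_range.1 hi
    have hj1 : (1 : ℝ) ≤ j := by linarith [(Nat.cast_nonneg i : (0 : ℝ) ≤ i)]
    have h3 : ((i : ℝ) + 1) * (f₀ + 4 * β ^ 2 - m) ≤ j * |f₀ + 4 * β ^ 2 - m| :=
      (mul_le_mul_of_nonneg_left (le_abs_self _) (by positivity)).trans
        (mul_le_mul_of_nonneg_right hij (abs_nonneg _))
    have h4 : ‖a 0‖ ^ 2 / 2 ≤ j * (‖a 0‖ ^ 2 / 2) := le_mul_of_one_le_left (by positivity) hj1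
    rw [hU, mul_add]
    exact (hwin N i).trans (add_le_add h3 h4)
  rw [← Finset.sum_div] at h1
  have hj0 : (0 : ℝ) ≤ j := Nat.cast_nonneg j
  nlinarith [mul_nonneg hU0 (mul_nonneg hj0 hS0), mul_nonneg hβ (sq_nonneg (j : ℝ))]

/-- The pairs `(a, b)` form a proximal point sequence of a monotone operator and satisfy the chord
bound, since `b` is bounded; hence both displacements decay like `k^(-1/2)`. -/
theorem primalDual_displacement_le_div_sqrt
    (hvar : ∀ k l, g k + inner ℝ (a (k + 1)) ((a (k + 1) - a k) - (a (l + 1) - a l))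
      + inner ℝ (b (k + 1) - b k) (b (k + 1) - b (l + 1)) ≤ g l)
    (hstar : ∀ k, g k + inner ℝ (a (k + 1)) (a (k + 1) - a k)
      + inner ℝ (b (k + 1) - b k) (b (k + 1) - bstar) ≤ f₀)
    (hb : ∀ k, ‖b k‖ ≤ β) (hbstar : ‖bstar‖ ≤ β) (hm : ∀ k, m ≤ g k) :
    ∃ A : ℝ, 0 ≤ A ∧ ∀ k : ℕ, ‖a (k + 1) - a k‖ ≤ A / √((k : ℝ) + 1) ∧
      ‖b (k + 1) - b k‖ ≤ A / √((k : ℝ) + 1) := by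
  have hβ : 0 ≤ β := (norm_nonneg _).trans hbstar
  obtain ⟨C, hC, hch⟩ := sum_chord_sq_le_of_variational_inequality hvar hstar hb hbstar hm
  set x : ℕ → WithLp 2 (H₁ × H₂) := fun k => WithLp.toLp 2 (a k, b k) with hx
  have hnorm : ∀ k l, ‖x k - x l‖ ^ 2 = ‖a k - a l‖ ^ 2 + ‖b k - b l‖ ^ 2 := fun k l => by
    rw [WithLp.prod_norm_sq_eq_of_L2]; rfl
  have ha_le : ∀ k l, ‖a k - a l‖ ≤ ‖x k - x l‖ := fun k l =>
    le_of_sq_le_sq (by rw [hnorm]; linarith [sq_nonneg ‖b k - b l‖]) (norm_nonneg _)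
  have hb_le : ∀ k l, ‖b k - b l‖ ≤ ‖x k - x l‖ := fun k l =>
    le_of_sq_le_sq (by rw [hnorm]; linarith [sq_nonneg ‖a k - a l‖]) (norm_nonneg _)
  have hmono : ∀ k l, inner ℝ (x (k + 1) - x (l + 1))
      ((x (k + 1) - x k) - (x (l + 1) - x l)) ≤ 0 := by
    intro k l
    have h1 := hvar k l
    have h2 := hvar l k
    have e : inner ℝ (x (k + 1) - x (l + 1)) ((x (k + 1) - x k) - (x (l + 1) - x l))
        = inner ℝ (a (k + 1) - a (l + 1)) ((a (k + 1) - a k) - (a (l + 1) - a l))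
          + inner ℝ (b (k + 1) - b (l + 1)) ((b (k + 1) - b k) - (b (l + 1) - b l)) := by
      rw [WithLp.prod_inner_apply]; rfl
    rw [e, inner_sub_left (a (k + 1)), real_inner_comm _ (b (k + 1) - b (l + 1)),
      inner_sub_left (b (k + 1) - b k)]
    rw [← neg_sub (a (k + 1) - a k), inner_neg_right] at h2
    rw [← neg_sub (b (k + 1)), inner_neg_right] at h2
    linarith
  obtain ⟨A, hA, hA'⟩ := displacement_le_div_sqrt (x := x) hmono
    (C := C + 4 * β ^ 2) (by positivity) (fun N j => by
      have h1 := hch N j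
      have h2 : ∑ k ∈ Finset.range N, ‖b (k + 1 + j) - b (k + 1)‖ ^ 2 ≤ N * (4 * β ^ 2) := by
        refine (Finset.sum_le_card_nsmul _ _ (4 * β ^ 2) fun k _ => ?_).trans (by simp)
        have h3 : ‖b (k + 1 + j) - b (k + 1)‖ ≤ 2 * β :=
          (norm_sub_le _ _).trans (by linarith [hb (k + 1 + j), hb (k + 1)])
        nlinarith [norm_nonneg (b (k + 1 + j) - b (k + 1))]
      have h3 : ∑ k ∈ Finset.range N, ‖b (k + 1) - b k‖
          ≤ ∑ k ∈ Finset.range N, ‖x (k + 1) - x k‖ := Finset.sum_le_sum fun k _ => hb_le _ _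
      simp only [hnorm, Finset.sum_add_distrib]
      have h4 : C * ((j : ℝ) ^ 2 + j * ∑ k ∈ Finset.range N, ‖b (k + 1) - b k‖)
          ≤ C * ((j : ℝ) ^ 2 + j * ∑ k ∈ Finset.range N, ‖x (k + 1) - x k‖) := by gcongr
      have h5 : 0 ≤ ∑ k ∈ Finset.range N, ‖x (k + 1) - x k‖ :=
        Finset.sum_nonneg fun _ _ => norm_nonneg _
      have h6 : 0 ≤ 4 * β ^ 2 * ((j : ℝ) ^ 2 + j * ∑ k ∈ Finset.range N, ‖x (k + 1) - x k‖) := by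
        positivity
      have h7 : 0 ≤ C * (N : ℝ) := by positivity
      linarith)
  exact ⟨A, hA, fun k => ⟨(ha_le _ _).trans (hA' k), (hb_le _ _).trans (hA' k)⟩⟩

/-- If the values are asymptotically at least the reference value `f₀`, they converge to it. No
dual solution is needed: `a` may be unbounded, but `‖a k‖ = o(√k)`, which the decay of its
displacements compensates. -/
theorem primalDual_eventually_le
    (hvar : ∀ k l, g k + inner ℝ (a (k + 1)) ((a (k + 1) - a k) - (a (l + 1) - a l))
      + inner ℝ (b (k + 1) - b k) (b (k + 1) - b (l + 1)) ≤ g l)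
    (hstar : ∀ k, g k + inner ℝ (a (k + 1)) (a (k + 1) - a k)
      + inner ℝ (b (k + 1) - b k) (b (k + 1) - bstar) ≤ f₀)
    (hb : ∀ k, ‖b k‖ ≤ β) (hbstar : ‖bstar‖ ≤ β) (hm : ∀ k, m ≤ g k)
    (hlim : ∀ δ > 0, ∀ᶠ k in Filter.atTop, f₀ - δ ≤ g k) {δ : ℝ} (hδ : 0 < δ) :
    ∀ᶠ k in Filter.atTop, g k ≤ f₀ + δ := by
  have hβ : 0 ≤ β := (norm_nonneg _).trans hbstar
  obtain ⟨A, hA, hA'⟩ := primalDual_displacement_le_div_sqrt hvar hstar hb hbstar hm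
  have hsqrt : Filter.Tendsto (fun k : ℕ => A / √((k : ℝ) + 1)) Filter.atTop (nhds 0) :=
    Filter.Tendsto.div_atTop tendsto_const_nhds (Real.tendsto_sqrt_atTop.comp
      (Filter.tendsto_atTop_add_const_right _ _ tendsto_natCast_atTop_atTop))
  have hst : ∀ k, g k + inner ℝ (a (k + 1)) (a (k + 1) - a k)
      ≤ f₀ + 2 * β * (A / √((k : ℝ) + 1)) := by
    intro k
    have h1 := inner_sub_le_two_mul_norm (b (k + 1) - b k) (hb (k + 1)) hbstar
    have h2 : 2 * β * ‖b (k + 1) - b k‖ ≤ 2 * β * (A / √((k : ℝ) + 1)) := by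
      gcongr; exact (hA' k).2
    linarith [hstar k]
  set c : ℕ → ℝ := fun k => max (f₀ - g k + 2 * β * (A / √((k : ℝ) + 1))) 0 with hc
  have hc0 : Filter.Tendsto c Filter.atTop (nhds 0) := by
    rw [Metric.tendsto_nhds]
    intro η hη
    have h2 : Filter.Tendsto (fun k : ℕ => 2 * β * (A / √((k : ℝ) + 1))) Filter.atTop (nhds 0) := by
      simpa using hsqrt.const_mul (2 * β)
    filter_upwards [hlim (η / 2) (by linarith), h2.eventually_lt_const (half_pos hη)] with k hk hk2
    rw [Real.dist_0_eq_abs, abs_of_nonneg (le_max_right _ _)]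
    exact max_lt (by linarith) hη
  have hgrow : ∀ n, ‖a n‖ ^ 2 ≤ ‖a 0‖ ^ 2 + 2 * ∑ i ∈ Finset.range n, c i := by
    intro n
    induction n with
    | zero => simp
    | succ n ih =>
      rw [Finset.sum_range_succ]
      have h1 := half_norm_sq_sub_le_inner (a n) (a (n + 1))
      have h2 := hst n
      have h3 : f₀ - g n + 2 * β * (A / √((n : ℝ) + 1)) ≤ c n := le_max_left _ _
      linarith
  have hratio : Filter.Tendsto (fun n : ℕ => ‖a n‖ / √(n : ℝ)) Filter.atTop (nhds 0) := by
    have h1 : Filter.Tendsto (fun n : ℕ => ‖a 0‖ ^ 2 / (n : ℝ)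
        + 2 * ((n : ℝ)⁻¹ * ∑ i ∈ Finset.range n, c i)) Filter.atTop (nhds 0) := by
      simpa using (tendsto_const_div_atTop_nhds_zero_nat (‖a 0‖ ^ 2)).add (hc0.cesaro.const_mul 2)
    have h2 : Filter.Tendsto (fun n : ℕ => ‖a n‖ ^ 2 / (n : ℝ)) Filter.atTop (nhds 0) := by
      refine squeeze_zero (fun n => by positivity) (fun n => ?_) h1
      calc ‖a n‖ ^ 2 / (n : ℝ) ≤ (‖a 0‖ ^ 2 + 2 * ∑ i ∈ Finset.range n, c i) / n := by
            gcongr; exact hgrow n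
        _ = _ := by ring
    have h3 := (Real.continuous_sqrt.tendsto 0).comp h2
    rw [Real.sqrt_zero] at h3
    refine h3.congr fun n => ?_
    simp only [Function.comp_apply]
    rw [Real.sqrt_div (sq_nonneg _), Real.sqrt_sq (norm_nonneg _)]
  have hfin : Filter.Tendsto (fun k : ℕ => ‖a (k + 1)‖ / √((k : ℝ) + 1) * A
      + 2 * β * (A / √((k : ℝ) + 1))) Filter.atTop (nhds 0) := by
    have h1 := (hratio.comp (Filter.tendsto_add_atTop_nat 1)).mul_const A
    have h2 := h1.add (hsqrt.const_mul (2 * β))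
    simpa [Function.comp_def] using h2
  filter_upwards [hfin.eventually_lt_const hδ] with k hk
  have h1 := neg_le_of_abs_le (abs_real_inner_le_norm (a (k + 1)) (a (k + 1) - a k))
  have h2 : ‖a (k + 1)‖ * ‖a (k + 1) - a k‖ ≤ ‖a (k + 1)‖ / √((k : ℝ) + 1) * A := by
    calc ‖a (k + 1)‖ * ‖a (k + 1) - a k‖ ≤ ‖a (k + 1)‖ * (A / √((k : ℝ) + 1)) := by
          gcongr; exact (hA' k).1
      _ = _ := by ring
  linarith [hst k]

/-- Cluster points of a sequence that solves, step by step, the variational inequality of an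
augmented Lagrangian method for minimizing `F` over the compact set `K` under the constraint
`B w = 0`: they are solutions. No multiplier for the constraint is assumed to exist. -/
theorem isMinOn_of_mapClusterPt_of_variational_inequality {X : Type*} [TopologicalSpace X]
    {K : Set X} (hK : IsCompact K) {F : X → ℝ} (hF : Continuous F) {B : X → H₁}
    (hB : Continuous B) {S : X → H₂} (hS : Continuous S) (hne : ∃ w ∈ K, B w = 0)
    {x : ℕ → X} (hx : ∀ k, x (k + 1) ∈ K) (hda : ∀ k, a (k + 1) - a k = B (x (k + 1)))
    (hVI : ∀ k, ∀ w ∈ K, F (x (k + 1)) + inner ℝ (a (k + 1)) (B (x (k + 1)) - B w)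
      + inner ℝ (S (x (k + 1)) - S (x k)) (S (x (k + 1)) - S w) ≤ F w)
    {xbar : X} (hclus : MapClusterPt xbar Filter.atTop x) :
    B xbar = 0 ∧ ∀ w ∈ K, B w = 0 → F xbar ≤ F w := by
  obtain ⟨w₀, hw₀, hBw₀⟩ := hne
  obtain ⟨ws, ⟨hws, hBws⟩, hmin⟩ :=
    (hK.inter_right (isClosed_eq hB continuous_const)).exists_isMinOn
      (f := F) ⟨w₀, hw₀, hBw₀⟩ hF.continuousOn
  have hBws : B ws = 0 := hBws
  obtain ⟨β, hβ⟩ := (hK.image hS).isBounded.exists_norm_le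
  obtain ⟨c, hc⟩ := (hK.image hF).bddBelow
  have hvar : ∀ k l, F (x (k + 1)) + inner ℝ (a (k + 1)) ((a (k + 1) - a k) - (a (l + 1) - a l))
      + inner ℝ (S (x (k + 1)) - S (x k)) (S (x (k + 1)) - S (x (l + 1))) ≤ F (x (l + 1)) :=
    fun k l => by
      rw [hda, hda]
      exact hVI k _ (hx l)
  have hstar : ∀ k, F (x (k + 1)) + inner ℝ (a (k + 1)) (a (k + 1) - a k)
      + inner ℝ (S (x (k + 1)) - S (x k)) (S (x (k + 1)) - S ws) ≤ F ws := fun k => by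
    have h := hVI k ws hws
    rwa [hBws, sub_zero, ← hda] at h
  have hb : ∀ k, ‖S (x k)‖ ≤ max β ‖S (x 0)‖ := fun k => by
    cases k with
    | zero => exact le_max_right _ _
    | succ k => exact (hβ _ (Set.mem_image_of_mem _ (hx k))).trans (le_max_left _ _)
  have hbs : ‖S ws‖ ≤ max β ‖S (x 0)‖ :=
    (hβ _ (Set.mem_image_of_mem _ hws)).trans (le_max_left _ _)
  have hlow : ∀ k, c ≤ F (x (k + 1)) := fun k => hc (Set.mem_image_of_mem _ (hx k))
  obtain ⟨A, -, hA⟩ := primalDual_displacement_le_div_sqrt (b := fun k => S (x k))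
    (g := fun k => F (x (k + 1))) hvar hstar hb hbs hlow
  have hres : Filter.Tendsto (fun k => ‖B (x (k + 1))‖) Filter.atTop (nhds 0) := by
    refine squeeze_zero (fun _ => norm_nonneg _) (fun k => (hda k ▸ (hA k).1)) ?_
    exact Filter.Tendsto.div_atTop tendsto_const_nhds (Real.tendsto_sqrt_atTop.comp
      (Filter.tendsto_atTop_add_const_right _ _ tendsto_natCast_atTop_atTop))
  have hzero : ∀ w, MapClusterPt w Filter.atTop (fun k => x (k + 1)) → B w = 0 := by
    intro w hw
    rw [← norm_le_zero_iff]
    refine le_of_forall_pos_le_add fun η hη => ?_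
    rw [zero_add]
    exact (isClosed_le hB.norm continuous_const).mem_of_mapClusterPt hw
      ((hres.eventually_lt_const hη).mono fun k hk => hk.le)
  -- no cluster point of the iterates lies below the constrained minimum
  have hlim : ∀ η > 0, ∀ᶠ k in Filter.atTop, F ws - η ≤ F (x (k + 1)) := by
    intro η hη
    by_contra hcon
    have hfreq : ∃ᶠ k in Filter.atTop, x (k + 1) ∈ K ∩ {w | F w ≤ F ws - η} :=
      (Filter.not_eventually.1 hcon).mono fun k hk => ⟨hx k, (not_le.1 hk).le⟩
    obtain ⟨w, ⟨hwK, hwF⟩, hw⟩ :=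
      (hK.inter_right (isClosed_le hF continuous_const)).exists_mapClusterPt_of_frequently hfreq
    have h1 := isMinOn_iff.1 hmin w ⟨hwK, hzero w hw⟩
    have h2 : F w ≤ F ws - η := hwF
    linarith
  have hclus' : MapClusterPt xbar Filter.atTop (fun k => x (k + 1)) := by
    rw [mapClusterPt_def, ← Filter.map_add_atTop_eq_nat 1, Filter.map_map] at hclus
    exact hclus
  refine ⟨hzero _ hclus', fun w hw hBw => ?_⟩
  refine le_trans ?_ (isMinOn_iff.1 hmin w ⟨hw, hBw⟩)
  refine le_of_forall_pos_le_add fun η hη => ?_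
  exact (isClosed_le hF continuous_const).mem_of_mapClusterPt hclus'
    (primalDual_eventually_le (b := fun k => S (x k)) (g := fun k => F (x (k + 1)))
      hvar hstar hb hbs hlow hlim hη)

end PrimalDual

/-! ### Signed incidence maps of a graph -/

section EdgeMap

variable {n d : ℕ} (G : SimpleGraph (Fin n)) [DecidableRel G.Adj]

/-- The map sending a vector-valued function `y` on the vertices to the function
`(i, j) ↦ y i + σ • y j` on the ordered pairs of adjacent vertices (and `0` on the other pairs).
For `σ = -1` it vanishes exactly on consensus if the graph is connected; for `σ = 1` it gives the
signless Laplacian. Each edge is counted twice. -/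
def edgeMap (σ : ℝ) : (Fin n → Vec d) →ₗ[ℝ] PiLp 2 (fun _ : Fin n × Fin n => Vec d) where
  toFun y := WithLp.toLp 2 fun e => if G.Adj e.1 e.2 then y e.1 + σ • y e.2 else 0
  map_add' y w := by
    ext1 e
    by_cases h : G.Adj e.1 e.2
    · simp only [PiLp.add_apply, h, if_true, Pi.add_apply, smul_add]; abel
    · simp [h]
  map_smul' c y := by
    ext1 e
    by_cases h : G.Adj e.1 e.2
    · simp only [PiLp.smul_apply, h, if_true, Pi.smul_apply, smul_add, RingHom.id_apply,
        smul_comm σ c]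
    · simp [h]

theorem edgeMap_apply (σ : ℝ) (y : Fin n → Vec d) (e : Fin n × Fin n) :
    edgeMap G σ y e = if G.Adj e.1 e.2 then y e.1 + σ • y e.2 else 0 := rfl

theorem continuous_edgeMap (σ : ℝ) : Continuous fun y : Fin n → Vec d => edgeMap G σ y := by
  refine (PiLp.continuous_toLp 2 _).comp (continuous_pi fun e => ?_)
  by_cases h : G.Adj e.1 e.2
  · simp only [h, if_true]; fun_prop
  · simp only [h, if_false]; exact continuous_const

theorem sum_neighborFinset_eq {M : Type*} [AddCommMonoid M] (i : Fin n) (f : Fin n → M) :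
    ∑ j ∈ G.neighborFinset i, f j = ∑ j, if G.Adj i j then f j else 0 := by
  rw [SimpleGraph.neighborFinset_eq_filter, Finset.sum_filter]

theorem inner_edgeMap {σ : ℝ} (hσ : σ * σ = 1) (s w : Fin n → Vec d) :
    inner ℝ (edgeMap G σ s) (edgeMap G σ w)
      = 2 * ∑ i, inner ℝ (w i) (∑ j ∈ G.neighborFinset i, (s i + σ • s j)) := by
  have h1 : ∀ i j : Fin n, inner ℝ (edgeMap G σ s (i, j)) (edgeMap G σ w (i, j))
      = (if G.Adj i j then inner ℝ (w i) (s i + σ • s j) else 0)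
        + (if G.Adj j i then inner ℝ (w j) (s j + σ • s i) else 0) := by
    intro i j
    rw [edgeMap_apply, edgeMap_apply]
    by_cases h : G.Adj i j
    · simp only [h, h.symm, if_true, inner_add_left, inner_add_right, inner_smul_left,
        inner_smul_right, RCLike.conj_to_real]
      rw [real_inner_comm (w i) (s i), real_inner_comm (w i) (s j), real_inner_comm (w j) (s i),
        real_inner_comm (w j) (s j)]
      linear_combination (inner ℝ (w j) (s j)) * hσ
    · have h' : ¬G.Adj j i := fun h' => h h'.symm
      simp [h, h']
  have h2 : ∀ i, inner ℝ (w i) (∑ j ∈ G.neighborFinset i, (s i + σ • s j))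
      = ∑ j, if G.Adj i j then inner ℝ (w i) (s i + σ • s j) else 0 := by
    intro i
    rw [inner_sum, sum_neighborFinset_eq]
  rw [PiLp.inner_apply, Fintype.sum_prod_type]
  simp only [h1, h2]
  simp only [Finset.sum_add_distrib]
  rw [Finset.sum_comm (f := fun i j => if G.Adj j i then inner ℝ (w j) (s j + σ • s i) else 0)]
  ring

theorem eq_of_edgeMap_neg_one_eq_zero (hG : G.Connected) {y : Fin n → Vec d}
    (h : edgeMap G (-1) y = 0) (i j : Fin n) : y i = y j := by
  have hadj : ∀ {i j : Fin n}, G.Adj i j → y i = y j := by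
    intro i j hij
    have h1 := congrArg (fun v => v.ofLp (i, j)) h
    have h2 := edgeMap_apply G (-1) y (i, j)
    rw [h2] at h1
    simpa [hij, ← sub_eq_add_neg, sub_eq_zero] using h1
  obtain ⟨p⟩ := hG.preconnected i j
  induction p with
  | nil => rfl
  | cons h _ ih => exact (hadj h).trans ih

theorem edgeMap_neg_one_eq_zero {y : Fin n → Vec d} (h : ∀ i j, y i = y j) :
    edgeMap G (-1) y = 0 := by
  ext1 e
  rw [edgeMap_apply, h e.1 e.2]
  simp

end EdgeMap

/-! ### Optimality condition of the local problems -/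

theorem nonneg_of_forall_add_mul_nonneg {A B : ℝ}
    (h : ∀ t : ℝ, 0 < t → t ≤ 1 → 0 ≤ t * A + t ^ 2 * B) : 0 ≤ A := by
  by_contra! hA
  have hB : 0 < |B| + 1 - A := by linarith [abs_nonneg B]
  have ht0 : 0 < -A / (|B| + 1 - A) := div_pos (by linarith) hB
  have ht1 : -A / (|B| + 1 - A) ≤ 1 := by rw [div_le_one hB]; linarith [abs_nonneg B]
  have h1 := h _ ht0 ht1
  set t := -A / (|B| + 1 - A) with ht
  have h2 : t * (|B| + 1 - A) = -A := div_mul_cancel₀ _ hB.ne'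
  have h3 : 0 ≤ A + t * B := by
    by_contra! hneg
    nlinarith
  nlinarith [le_abs_self B]

/-- First-order optimality for a convex function plus a linear term and a sum of squared
distances in the first variable. -/
theorem variational_inequality_of_isMinOn {E₁ E₂ ι : Type*} [NormedAddCommGroup E₁]
    [InnerProductSpace ℝ E₁] [AddCommGroup E₂] [Module ℝ E₂] {s : Set (E₁ × E₂)}
    (hs : Convex ℝ s) {F : E₁ × E₂ → ℝ} (hF : ConvexOn ℝ Set.univ F) (q : E₁) (ρ : ℝ)
    (T : Finset ι) (c : ι → E₁) {x w : E₁ × E₂} (hx : x ∈ s) (hw : w ∈ s)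
    (hmin : IsMinOn (fun v => F v + inner ℝ v.1 q + ρ * ∑ j ∈ T, ‖v.1 - c j‖ ^ 2) s x) :
    F x + inner ℝ (x.1 - w.1) (q + (2 * ρ) • ∑ j ∈ T, (x.1 - c j)) ≤ F w := by
  have key : 0 ≤ F w - F x + inner ℝ (w.1 - x.1) (q + (2 * ρ) • ∑ j ∈ T, (x.1 - c j)) := by
    refine nonneg_of_forall_add_mul_nonneg (B := ρ * ∑ j ∈ T, ‖w.1 - x.1‖ ^ 2)
      fun t ht0 ht1 => ?_
    have hmem : (1 - t) • x + t • w ∈ s :=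
      hs hx hw (by linarith) ht0.le (by ring)
    have h1 := isMinOn_iff.1 hmin _ hmem
    have h2 := hF.2 (Set.mem_univ x) (Set.mem_univ w) (by linarith : 0 ≤ 1 - t) ht0.le (by ring)
    have e1 : ((1 - t) • x + t • w).1 = x.1 + t • (w.1 - x.1) := by
      rw [Prod.fst_add, Prod.smul_fst, Prod.smul_fst, smul_sub, sub_smul, one_smul]; abel
    have e2 : ∑ j ∈ T, ‖x.1 + t • (w.1 - x.1) - c j‖ ^ 2
        = ∑ j ∈ T, ‖x.1 - c j‖ ^ 2 + 2 * t * inner ℝ (w.1 - x.1) (∑ j ∈ T, (x.1 - c j))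
          + t ^ 2 * ∑ j ∈ T, ‖w.1 - x.1‖ ^ 2 := by
      rw [inner_sum, Finset.mul_sum, Finset.mul_sum, ← Finset.sum_add_distrib,
        ← Finset.sum_add_distrib]
      refine Finset.sum_congr rfl fun j _ => ?_
      rw [add_sub_right_comm, norm_add_sq_real, inner_smul_right, norm_smul, mul_pow,
        Real.norm_eq_abs, sq_abs, real_inner_comm]
      ring
    simp only [e1, inner_add_left, inner_smul_left, RCLike.conj_to_real] at h1
    rw [e2] at h1
    simp only [smul_eq_mul] at h2
    rw [inner_add_right, inner_smul_right]
    linarith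
  rw [← neg_sub w.1 x.1, inner_neg_left]
  linarith

namespace ConvexSIP

variable {n d m : ℕ} {p : Fin n → ℕ} (P : ConvexSIP n d m p)

/-- The sum of the local objectives, each agent having its own copy of the global variable. -/
def splitObjective (w : (Fin n → Vec d) × ((i : Fin n) → Vec (p i))) : ℝ :=
  ∑ i, (P.φ i (w.2 i) + P.h i (w.1 i))

theorem convex_cutFeasibleSet (i : Fin n) {C : Set (Vec m)} (hC : C ⊆ P.Ξ) :
    Convex ℝ (P.cutFeasibleSet i C) := by
  intro u hu v hv a b ha hb hab
  refine ⟨P.convex_Y hu.1 hv.1 ha hb hab, P.convex_Z i hu.2.1 hv.2.1 ha hb hab, fun ζ hζ => ?_⟩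
  have h := (P.convex_g i ζ (hC hζ)).2 (Set.mem_univ u) (Set.mem_univ v) ha hb hab
  refine h.trans ?_
  have h1 := mul_nonpos_of_nonneg_of_nonpos ha (hu.2.2 ζ hζ)
  have h2 := mul_nonpos_of_nonneg_of_nonpos hb (hv.2.2 ζ hζ)
  simp only [smul_eq_mul]
  linarith

theorem convexOn_local (i : Fin n) :
    ConvexOn ℝ Set.univ fun w : Vec d × Vec (p i) => P.φ i w.2 + P.h i w.1 :=
  ((P.convex_φ i).comp_linearMap (LinearMap.snd ℝ (Vec d) (Vec (p i)))).add
    ((P.convex_h i).comp_linearMap (LinearMap.fst ℝ (Vec d) (Vec (p i))))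

theorem continuous_φ (i : Fin n) : Continuous (P.φ i) :=
  continuousOn_univ.1 ((P.convex_φ i).continuousOn isOpen_univ)

theorem continuous_h (i : Fin n) : Continuous (P.h i) :=
  continuousOn_univ.1 ((P.convex_h i).continuousOn isOpen_univ)

theorem continuous_g (i : Fin n) : Continuous (P.g i) := (P.lipschitz_g i).continuous

theorem continuous_splitObjective : Continuous P.splitObjective := by
  unfold splitObjective
  refine continuous_finsetSum _ fun i _ => ?_
  have h1 := P.continuous_φ i
  have h2 := P.continuous_h i
  fun_prop

/-- The product of the cut feasibility sets of the agents. -/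
def splitFeasibleSet (C : Fin n → Set (Vec m)) :
    Set ((Fin n → Vec d) × ((i : Fin n) → Vec (p i))) :=
  {w | ∀ i, (w.1 i, w.2 i) ∈ P.cutFeasibleSet i (C i)}

theorem isClosed_cutFeasibleSet (i : Fin n) (C : Set (Vec m)) :
    IsClosed (P.cutFeasibleSet i C) := by
  have hg := P.continuous_g i
  have e : P.cutFeasibleSet i C = (Prod.fst ⁻¹' P.Y) ∩ ((Prod.snd ⁻¹' P.Z i) ∩
      ⋂ ζ ∈ C, {w | P.g i (w.1, w.2, ζ) ≤ 0}) := by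
    ext w; simp [cutFeasibleSet]
  rw [e]
  refine (P.compact_Y.isClosed.preimage continuous_fst).inter
    (((P.compact_Z i).isClosed.preimage continuous_snd).inter ?_)
  exact isClosed_biInter fun ζ _ => isClosed_le (by fun_prop) continuous_const

theorem isCompact_splitFeasibleSet (C : Fin n → Set (Vec m)) :
    IsCompact (P.splitFeasibleSet C) := by
  have hK : IsCompact ((Set.univ.pi fun _ : Fin n => P.Y) ×ˢ Set.univ.pi P.Z) :=
    (isCompact_univ_pi fun _ => P.compact_Y).prod (isCompact_univ_pi P.compact_Z)
  refine hK.of_isClosed_subset ?_ fun w hw => ⟨fun i _ => (hw i).1, fun i _ => (hw i).2.1⟩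
  have e : P.splitFeasibleSet C
      = ⋂ i, (fun w : (Fin n → Vec d) × ((i : Fin n) → Vec (p i)) => (w.1 i, w.2 i)) ⁻¹'
          P.cutFeasibleSet i (C i) := by
    ext w; simp [splitFeasibleSet]
  rw [e]
  exact isClosed_iInter fun i => (P.isClosed_cutFeasibleSet i (C i)).preimage (by fun_prop)

end ConvexSIP

namespace ConvexSIP.IsCuttingSurfaceADMM

open Filter Topology

variable {n d m : ℕ} {p : Fin n → ℕ} {P : ConvexSIP n d m p}
  {G : SimpleGraph (Fin n)} [DecidableRel G.Adj] {ρ ε : ℝ}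
  {y : ℕ → Fin n → Vec d} {z : ℕ → (i : Fin n) → Vec (p i)} {q : ℕ → Fin n → Vec d}
  {ξ : ℕ → Fin n → Vec m} {C : ℕ → Fin n → Set (Vec m)}

/-! ### Finite termination of the cuts -/

theorem y_mem (hrun : P.IsCuttingSurfaceADMM G ρ ε y z q ξ C) (k : ℕ) (i : Fin n) :
    y k i ∈ P.Y := by
  cases k with
  | zero => exact hrun.y_init i
  | succ k => exact (hrun.primal_mem k i).1

theorem cuts_subset (hrun : P.IsCuttingSurfaceADMM G ρ ε y z q ξ C) (k : ℕ) (i : Fin n) :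
    C k i ⊆ P.Ξ := by
  induction k with
  | zero => rw [hrun.C_init]; exact Set.empty_subset _
  | succ k ih =>
    rw [hrun.C_step]
    split_ifs
    · exact Set.union_subset ih (Set.singleton_subset_iff.2 (hrun.ξ_mem k i))
    · exact ih

theorem monotone_cuts (hrun : P.IsCuttingSurfaceADMM G ρ ε y z q ξ C) (i : Fin n) :
    Monotone fun k => C k i := by
  refine monotone_nat_of_le_succ fun k => ?_
  rw [hrun.C_step]
  split_ifs
  · exact Set.subset_union_left
  · exact le_rfl

/-- If cuts were added forever, a limit of the violated triples would have constraint value at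
least `ε / 2`; but later iterates satisfy the earlier cuts, so that value is also at most `0`. -/
theorem eventually_not_violated (hrun : P.IsCuttingSurfaceADMM G ρ ε y z q ξ C) (hε : 0 < ε)
    (i : Fin n) :
    ∀ᶠ k in atTop, ¬ε / 2 < P.g i (y (k + 1) i, z (k + 1) i, ξ (k + 1) i) := by
  by_contra hcon
  obtain ⟨φ, hφ, hbad⟩ := extraction_of_frequently_atTop
    ((not_eventually.1 hcon).mono fun k hk => not_not.1 hk)
  have hK : IsCompact (P.Y ×ˢ P.Z i ×ˢ P.Ξ) := P.compact_Y.prod ((P.compact_Z i).prod P.compact_Ξ)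
  obtain ⟨⟨u, v, ζ⟩, -, ψ, hψ, hlim⟩ := hK.tendsto_subseq
    (x := fun j => (y (φ j + 1) i, z (φ j + 1) i, ξ (φ j + 1) i))
    fun j => ⟨hrun.y_mem _ i, (hrun.primal_mem _ i).2.1, hrun.ξ_mem _ i⟩
  have hy : Tendsto (fun j => y (φ (ψ j) + 1) i) atTop (𝓝 u) :=
    (continuous_fst.tendsto _).comp hlim
  have hz : Tendsto (fun j => z (φ (ψ j) + 1) i) atTop (𝓝 v) :=
    ((continuous_fst.comp continuous_snd).tendsto _).comp hlim
  have hξ : Tendsto (fun j => ξ (φ (ψ j) + 1) i) atTop (𝓝 ζ) :=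
    ((continuous_snd.comp continuous_snd).tendsto _).comp hlim
  have hlow : ε / 2 ≤ P.g i (u, v, ζ) :=
    ge_of_tendsto (((P.continuous_g i).tendsto _).comp hlim)
      (Eventually.of_forall fun j => (hbad (ψ j)).le)
  have hup : P.g i (u, v, ζ) ≤ 0 := by
    have hlim' : Tendsto (fun j => (y (φ (ψ (j + 1)) + 1) i, z (φ (ψ (j + 1)) + 1) i,
        ξ (φ (ψ j) + 1) i)) atTop (𝓝 (u, v, ζ)) :=
      (hy.comp (tendsto_add_atTop_nat 1)).prodMk_nhds
        ((hz.comp (tendsto_add_atTop_nat 1)).prodMk_nhds hξ)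
    refine le_of_tendsto (((P.continuous_g i).tendsto _).comp hlim')
      (Eventually.of_forall fun j => ?_)
    refine (hrun.primal_mem (φ (ψ (j + 1))) i).2.2 _ ?_
    have hlt : φ (ψ j) + 1 ≤ φ (ψ (j + 1)) := hφ (hψ (Nat.lt_succ_self j))
    refine hrun.monotone_cuts i hlt ?_
    simp only
    rw [hrun.C_step, if_pos (hbad (ψ j))]
    exact Or.inr rfl
  linarith

theorem exists_cuts_eq (hrun : P.IsCuttingSurfaceADMM G ρ ε y z q ξ C) (hε : 0 < ε) :
    ∃ K : ℕ, 1 ≤ K ∧ ∀ k, K ≤ k → C k = C K := by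
  obtain ⟨K, hK⟩ := eventually_atTop.1
    (eventually_all.2 fun i => hrun.eventually_not_violated hε i)
  refine ⟨K + 1, Nat.le_add_left 1 K, fun k hk => ?_⟩
  induction k, hk using Nat.le_induction with
  | base => rfl
  | succ k hk ih =>
    rw [← ih]
    funext i
    rw [hrun.C_step, if_neg (hK k (by omega) i)]

/-! ### Convergence with fixed cuts -/

theorem dual_eq (hrun : P.IsCuttingSurfaceADMM G ρ ε y z q ξ C) (k : ℕ) (i : Fin n) :
    q k i = ρ • ∑ j ∈ G.neighborFinset i,
      ((∑ l ∈ Finset.range k, y l) i - (∑ l ∈ Finset.range k, y l) j) := by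
  induction k with
  | zero => simp [hrun.q_init]
  | succ k ih =>
    rw [hrun.q_step, ih, ← smul_add, ← Finset.sum_add_distrib]
    congr 1
    refine Finset.sum_congr rfl fun j _ => ?_
    rw [Finset.sum_range_succ, Pi.add_apply, Pi.add_apply]
    abel

/-- The optimality conditions of all local problems of one iteration, summed over the agents and
written with the signed incidence maps: the dual variable enters through the partial sums of the
primal iterates, the quadratic term through the change of the iterates. -/
theorem sum_variational_inequality (hrun : P.IsCuttingSurfaceADMM G ρ ε y z q ξ C) (k : ℕ)
    {w : (Fin n → Vec d) × ((i : Fin n) → Vec (p i))} (hw : w ∈ P.splitFeasibleSet (C k)) :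
    P.splitObjective (y (k + 1), z (k + 1))
      + ρ / 2 * (inner ℝ (edgeMap G (-1) (∑ l ∈ Finset.range (k + 2), y l))
          (edgeMap G (-1) (y (k + 1) - w.1))
        + inner ℝ (edgeMap G 1 (y (k + 1) - y k)) (edgeMap G 1 (y (k + 1) - w.1)))
      ≤ P.splitObjective w := by
  have hloc : ∀ i, (P.φ i (z (k + 1) i) + P.h i (y (k + 1) i))
      + inner ℝ (y (k + 1) i - w.1 i) (q (k + 1) i + (2 * ρ) • ∑ j ∈ G.neighborFinset i,
          (y (k + 1) i - (1 / 2 : ℝ) • (y k i + y k j)))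
      ≤ P.φ i (w.2 i) + P.h i (w.1 i) := fun i =>
    variational_inequality_of_isMinOn (x := (y (k + 1) i, z (k + 1) i)) (w := (w.1 i, w.2 i))
      (F := fun v => P.φ i v.2 + P.h i v.1)
      (P.convex_cutFeasibleSet i (hrun.cuts_subset k i)) (P.convexOn_local i) (q (k + 1) i) ρ
      (G.neighborFinset i) (fun j => (1 / 2 : ℝ) • (y k i + y k j)) (hrun.primal_mem k i) (hw i)
      (hrun.primal_min k i)
  have hgrad : ∀ i, q (k + 1) i + (2 * ρ) • ∑ j ∈ G.neighborFinset i,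
        (y (k + 1) i - (1 / 2 : ℝ) • (y k i + y k j))
      = ρ • (∑ j ∈ G.neighborFinset i, ((∑ l ∈ Finset.range (k + 2), y l) i
            + (-1 : ℝ) • (∑ l ∈ Finset.range (k + 2), y l) j)
          + ∑ j ∈ G.neighborFinset i, ((y (k + 1) - y k) i + (1 : ℝ) • (y (k + 1) - y k) j)) := by
    intro i
    rw [hrun.dual_eq, mul_comm, mul_smul, ← smul_add, Finset.smul_sum, ← Finset.sum_add_distrib,
      ← Finset.sum_add_distrib]
    congr 1
    refine Finset.sum_congr rfl fun j _ => ?_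
    rw [Finset.sum_range_succ _ (k + 1)]
    simp only [Pi.add_apply, Pi.sub_apply]
    module
  rw [inner_edgeMap G (by norm_num), inner_edgeMap G (by norm_num)]
  have hsum := Finset.sum_le_sum fun i (_ : i ∈ Finset.univ) => hloc i
  simp only [hgrad, inner_smul_right, inner_add_right] at hsum
  simp only [splitObjective, Pi.sub_apply, Finset.sum_add_distrib, ← Finset.mul_sum] at hsum ⊢
  linarith

/-- Once the cuts are fixed, the cluster points of the iterates solve the program with the final
cuts, which is a relaxation of the semi-infinite program. -/
theorem consensus_and_splitObjective_le_of_mapClusterPt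
    (hrun : P.IsCuttingSurfaceADMM G ρ ε y z q ξ C) (hfeas : P.feasibleSet.Nonempty)
    (hG : G.Connected) (hρ : 0 < ρ) {K : ℕ} (hK : ∀ k, K ≤ k → C k = C K)
    {w : (Fin n → Vec d) × ((i : Fin n) → Vec (p i))}
    (hclus : MapClusterPt w atTop fun k => (y k, z k)) :
    (∀ i j, w.1 i = w.1 j) ∧ P.splitObjective w ≤ P.optimalValue := by
  have hρ' : 0 < 2 / ρ := by positivity
  have hmem : ∀ k, (y (K + (k + 1)), z (K + (k + 1))) ∈ P.splitFeasibleSet (C K) := fun k i => by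
    rw [← hK (K + k) (Nat.le_add_right K k)]
    exact hrun.primal_mem (K + k) i
  have hembed : ∀ v ∈ P.feasibleSet, ((fun _ => v.1, v.2) :
      (Fin n → Vec d) × ((i : Fin n) → Vec (p i))) ∈ P.splitFeasibleSet (C K) := fun v hv i =>
    ⟨hv.1, hv.2.1 i, fun ζ hζ => hv.2.2 i ζ (hrun.cuts_subset K i hζ)⟩
  have hcons : ∀ v : Vec d, edgeMap G (-1) (fun _ => v) = 0 := fun v =>
    edgeMap_neg_one_eq_zero G fun _ _ => rfl
  obtain ⟨v₀, hv₀⟩ := hfeas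
  have hclus' : MapClusterPt w atTop fun k => (y (K + k), z (K + k)) := by
    rw [mapClusterPt_def, ← map_add_atTop_eq_nat K, map_map] at hclus
    simpa only [mapClusterPt_def, Function.comp_def, add_comm] using hclus
  obtain ⟨h0, hle⟩ := isMinOn_of_mapClusterPt_of_variational_inequality
    (a := fun k => edgeMap G (-1) (∑ l ∈ Finset.range (K + k + 1), y l))
    (P.isCompact_splitFeasibleSet (C K))
    (F := fun v => 2 / ρ * P.splitObjective v) (P.continuous_splitObjective.const_mul _)
    (B := fun v => edgeMap G (-1) v.1) ((continuous_edgeMap G (-1)).comp continuous_fst)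
    (S := fun v => edgeMap G 1 v.1) ((continuous_edgeMap G 1).comp continuous_fst)
    ⟨_, hembed v₀ hv₀, hcons _⟩
    hmem (fun k => by
      rw [← map_sub, ← add_assoc K k 1, Finset.sum_range_succ _ (K + k + 1), add_sub_cancel_left])
    (fun k v hv => by
      rw [← hK (K + k) (Nat.le_add_right K k)] at hv
      have h := mul_le_mul_of_nonneg_left (hrun.sum_variational_inequality (K + k) hv) hρ'.le
      rw [mul_add, ← mul_assoc (2 / ρ) (ρ / 2), show 2 / ρ * (ρ / 2) = 1 by field_simp,
        one_mul, ← add_assoc, map_sub, map_sub, map_sub] at h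
      exact h)
    hclus'
  refine ⟨eq_of_edgeMap_neg_one_eq_zero G hG h0, le_csInf ⟨_, Set.mem_image_of_mem _ hv₀⟩ ?_⟩
  rintro _ ⟨v, hv, rfl⟩
  exact le_of_mul_le_mul_left (hle _ (hembed v hv) (hcons _)) hρ'

/-- An iterate that triggers no new cut has constraint values at most `ε / 2` at the approximate
maximizer, and the latter is optimal up to `ε / 2`. -/
theorem eventually_constraint_le (hrun : P.IsCuttingSurfaceADMM G ρ ε y z q ξ C) (hε : 0 < ε)
    (i : Fin n) : ∀ᶠ k in atTop, ∀ ζ ∈ P.Ξ, P.g i (y k i, z k i, ζ) ≤ ε := by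
  rw [← map_add_atTop_eq_nat 1]
  change ∀ᶠ k in atTop, ∀ ζ ∈ P.Ξ, P.g i (y (k + 1) i, z (k + 1) i, ζ) ≤ ε
  filter_upwards [hrun.eventually_not_violated hε i] with k hk ζ hζ
  linarith [hrun.ξ_approx k i ζ hζ]

end ConvexSIP.IsCuttingSurfaceADMM

theorem proposition1 {n d m : ℕ} {p : Fin n → ℕ} (P : ConvexSIP n d m p)
    (hfeas : P.feasibleSet.Nonempty)
    (G : SimpleGraph (Fin n)) [DecidableRel G.Adj] (hG : G.Connected)
    (ρ ε : ℝ) (hρ : 0 < ρ) (hε : 0 < ε)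
    (y : ℕ → Fin n → Vec d) (z : ℕ → (i : Fin n) → Vec (p i)) (q : ℕ → Fin n → Vec d)
    (ξ : ℕ → Fin n → Vec m) (C : ℕ → Fin n → Set (Vec m))
    (hrun : P.IsCuttingSurfaceADMM G ρ ε y z q ξ C) :
    (∃ K : ℕ, 1 ≤ K ∧ ∀ k₁ k₂ : ℕ, K ≤ k₁ → K ≤ k₂ → ∀ i, C k₁ i = C k₂ i) ∧
    ∀ (ybar : Fin n → Vec d) (zbar : (i : Fin n) → Vec (p i)),
      MapClusterPt (ybar, zbar) Filter.atTop (fun k => (y k, z k)) →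
        (∀ i j, ybar i = ybar j) ∧
        (∀ i, ∀ ζ ∈ P.Ξ, P.g i (ybar i, zbar i, ζ) ≤ ε) ∧
        ∑ i, (P.φ i (zbar i) + P.h i (ybar i)) ≤ P.optimalValue := by
  obtain ⟨K, hK1, hK⟩ := hrun.exists_cuts_eq hε
  refine ⟨⟨K, hK1, fun k₁ k₂ h₁ h₂ i => by rw [hK k₁ h₁, hK k₂ h₂]⟩, fun ybar zbar hclus => ?_⟩
  obtain ⟨hcons, hval⟩ :=
    hrun.consensus_and_splitObjective_le_of_mapClusterPt hfeas hG hρ hK hclus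
  refine ⟨hcons, fun i ζ hζ => ?_, hval⟩
  have hg := P.continuous_g i
  have hcl : IsClosed {w : (Fin n → Vec d) × ((i : Fin n) → Vec (p i)) |
      P.g i (w.1 i, w.2 i, ζ) ≤ ε} := isClosed_le (by fun_prop) continuous_const
  exact hcl.mem_of_mapClusterPt hclus
    ((hrun.eventually_constraint_le hε i).mono fun k hk => hk ζ hζ)
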